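/- Let $\varphi := \frac{1+\sqrt5}{2}$ be the golden ratio, and let $\mathcal R_\varphi := (\mathbb R, <, +, \mathbb Z, \mathbb Z\varphi)$ be the first-order structure on the real numbers whose primitives are the order, the addition, and unary predicates for the sets $\mathbb Z$ and $\mathbb Z\varphi=\{k\varphi : k\in\mathbb Z\}$. Then the function $\lambda_\varphi:\mathbb R\to\mathbb R$, $x\mapsto \varphi x$, is definable without parameters in $\mathcal R_\varphi$; that is, its graph $\{(x,y)\in\mathbb R^2 : y=\varphi x\}$ is defined by a first-order formula in the language of $\mathcal R_\varphi$ without parameters. -/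

import Mathlib

/-- Function symbols of the language `{<, +, P, Q}`: one binary symbol for addition. -/
inductive RFunctions : ℕ → Type
  | add : RFunctions 2

/-- Relation symbols of the language `{<, +, P, Q}`: a binary symbol for the order and two unary
predicate symbols, to be interpreted as `ℤ` and as `ℤ a`. -/
inductive RRelations : ℕ → Type
  | lt : RRelations 2
  | isInt : RRelations 1
  | isIntMul : RRelations 1

/-- The first-order language `{<, +, P, Q}` of the structures `(ℝ, <, +, ℤ, ℤ a)`. -/
def RLang : FirstOrder.Language.{0, 0} where
  Functions := RFunctions
  Relations := RRelations

/-- The structure `(ℝ, <, +, ℤ, ℤ a)`, for a real number `a`. -/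
@[reducible]
def RStructure (a : ℝ) : RLang.Structure ℝ where
  funMap
    | RFunctions.add, v => v 0 + v 1
  RelMap
    | RRelations.lt, v => v 0 < v 1
    | RRelations.isInt, v => ∃ k : ℤ, v 0 = k
    | RRelations.isIntMul, v => ∃ k : ℤ, v 0 = k * a

/-- A function `f : ℝ → ℝ` is definable (without parameters) in `(ℝ, <, +, ℤ, ℤ a)` if its graph
`{(x, y) | y = f x}` is a definable subset of `ℝ × ℝ`. -/
def DefinableInR (a : ℝ) (f : ℝ → ℝ) : Prop :=
  letI : RLang.Structure ℝ := RStructure a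
  (∅ : Set ℝ).Definable₂ RLang {p : ℝ × ℝ | p.2 = f p.1}

/-! The primitives give `ℤ` and `ℤφ` as sets, so the difficulty is to define the pairing of `n` with
`nφ`. The device is the conjugate `ψ = -1/φ`: since `ψ(mφ - n) = nφ - (m + n)`, multiplication by
`ψ` on points of `ℤ + ℤφ` exposes `nφ`, and irrationality makes the coefficients unique.

On the points `mφ - n`, `m ≥ 0`, of `(ψ, ψ²)`, multiplication by `ψ` shifts the Ostrowski
(Fibonacci) digits by one place (`eq_goldenConj_mul_iff`), and the digits determine the point
(`FracPoint.eq_of_digits`). Digits are first-order expressible because the pairs `(F_k φ, F_{k+1})`,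
`k ≥ 2`, are exactly the best approximations (`bestApprox_iff`), the next Fibonacci number is
singled out by order and addition (`fib_lt_and_le_two_mul_iff`), and the required powers of `ψ` are
differences of such pairs.

This pairs `n` with `nφ` for enough integers that their differences give all of `ℤ`
(`exists_eq_sub_isShiftedInt`). Then `φ(j + lφ) = jφ + lφ + l` defines multiplication by `φ` on the
dense group `ℤ + ℤφ`, and monotonicity extends it to `ℝ`. -/

/-! ### Closure properties of definable predicates and terms. -/

/-- A predicate on assignments `α → ℝ` that is definable without parameters in
`(ℝ, <, +, ℤ, ℤ a)`. -/
def DefinablePred (a : ℝ) {α : Type} (P : (α → ℝ) → Prop) : Prop :=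
  letI : RLang.Structure ℝ := RStructure a
  (∅ : Set ℝ).Definable RLang {v : α → ℝ | P v}

/-- A real function of assignments `α → ℝ` whose graph is definable without parameters in
`(ℝ, <, +, ℤ, ℤ a)`. -/
def DefinableTerm (a : ℝ) {α : Type} (t : (α → ℝ) → ℝ) : Prop :=
  DefinablePred a fun w : α ⊕ Fin 1 → ℝ => w (Sum.inr 0) = t (w ∘ Sum.inl)

namespace DefinablePred

variable {a : ℝ} {α β : Type}

theorem congr {P Q : (α → ℝ) → Prop} (hP : DefinablePred a P) (h : ∀ v, Q v ↔ P v) :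
    DefinablePred a Q := by
  rwa [show Q = P from funext fun v => propext (h v)]

theorem and {P Q : (α → ℝ) → Prop} (hP : DefinablePred a P) (hQ : DefinablePred a Q) :
    DefinablePred a fun v => P v ∧ Q v :=
  letI : RLang.Structure ℝ := RStructure a
  Set.Definable.inter hP hQ

theorem or {P Q : (α → ℝ) → Prop} (hP : DefinablePred a P) (hQ : DefinablePred a Q) :
    DefinablePred a fun v => P v ∨ Q v :=
  letI : RLang.Structure ℝ := RStructure a
  Set.Definable.union hP hQ

theorem not {P : (α → ℝ) → Prop} (hP : DefinablePred a P) : DefinablePred a fun v => ¬ P v :=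
  letI : RLang.Structure ℝ := RStructure a
  Set.Definable.compl hP

theorem imp {P Q : (α → ℝ) → Prop} (hP : DefinablePred a P) (hQ : DefinablePred a Q) :
    DefinablePred a fun v => P v → Q v :=
  (hP.not.or hQ).congr fun _ => imp_iff_not_or

theorem iff {P Q : (α → ℝ) → Prop} (hP : DefinablePred a P) (hQ : DefinablePred a Q) :
    DefinablePred a fun v => (P v ↔ Q v) :=
  ((hP.imp hQ).and (hQ.imp hP)).congr fun _ => iff_iff_implies_and_implies

theorem comp (f : α → β) {P : (α → ℝ) → Prop} (hP : DefinablePred a P) :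
    DefinablePred a fun v : β → ℝ => P (v ∘ f) :=
  letI : RLang.Structure ℝ := RStructure a
  Set.Definable.preimage_comp f hP

theorem ex {P : (α → ℝ) → ℝ → Prop}
    (hP : DefinablePred a fun w : α ⊕ Fin 1 → ℝ => P (w ∘ Sum.inl) (w (Sum.inr 0))) :
    DefinablePred a fun v => ∃ x, P v x := by
  let : RLang.Structure ℝ := RStructure a
  have h := Set.Definable.image_comp_sumInl_fin 1 hP
  refine DefinablePred.congr
    (P := (· ∈ (fun g : α ⊕ Fin 1 → ℝ => g ∘ Sum.inl) '' {w | P (w ∘ Sum.inl) (w (Sum.inr 0))}))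
    h fun v => ⟨?_, ?_⟩
  · rintro ⟨x, hx⟩
    exact ⟨Sum.elim v fun _ => x, hx, rfl⟩
  · rintro ⟨w, hw, rfl⟩
    exact ⟨_, hw⟩

theorem all {P : (α → ℝ) → ℝ → Prop}
    (hP : DefinablePred a fun w : α ⊕ Fin 1 → ℝ => P (w ∘ Sum.inl) (w (Sum.inr 0))) :
    DefinablePred a fun v => ∀ x, P v x :=
  (ex (P := fun v x => ¬ P v x) hP.not).not.congr fun _ => not_exists_not.symm

theorem var_lt (i j : α) : DefinablePred a fun v : α → ℝ => v i < v j := by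
  let : RLang.Structure ℝ := RStructure a
  refine Set.empty_definable_iff.2 ⟨FirstOrder.Language.Relations.formula₂
    (RRelations.lt : RLang.Relations 2) (.var i) (.var j), ?_⟩
  rfl

theorem var_isInt (i : α) : DefinablePred a fun v : α → ℝ => ∃ k : ℤ, v i = k := by
  let : RLang.Structure ℝ := RStructure a
  refine Set.empty_definable_iff.2 ⟨FirstOrder.Language.Relations.formula₁
    (RRelations.isInt : RLang.Relations 1) (.var i), ?_⟩
  rfl

theorem var_isIntMul (i : α) : DefinablePred a fun v : α → ℝ => ∃ k : ℤ, v i = k * a := by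
  let : RLang.Structure ℝ := RStructure a
  refine Set.empty_definable_iff.2 ⟨FirstOrder.Language.Relations.formula₁
    (RRelations.isIntMul : RLang.Relations 1) (.var i), ?_⟩
  rfl

theorem var_eq_add (i j k : α) : DefinablePred a fun v : α → ℝ => v i = v j + v k := by
  let : RLang.Structure ℝ := RStructure a
  refine Set.empty_definable_iff.2 ⟨FirstOrder.Language.Term.equal (.var i)
    (FirstOrder.Language.Functions.apply₂ (RFunctions.add : RLang.Functions 2)
      (.var j) (.var k)), ?_⟩
  rfl

theorem var_eq (i j : α) : DefinablePred a fun v : α → ℝ => v i = v j :=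
  ((var_lt i j).or (var_lt j i)).not.congr fun _ => by
    rw [lt_or_lt_iff_ne, not_ne_iff]

/-- A definable predicate of one real variable may be applied to a definable term. -/
theorem subst {P : (α → ℝ) → ℝ → Prop} {t : (α → ℝ) → ℝ}
    (hP : DefinablePred a fun w : α ⊕ Fin 1 → ℝ => P (w ∘ Sum.inl) (w (Sum.inr 0)))
    (ht : DefinableTerm a t) : DefinablePred a fun v => P v (t v) :=
  (ex (P := fun v x => x = t v ∧ P v x) (ht.and hP)).congr fun _ => exists_eq_left.symm

end DefinablePred

namespace DefinableTerm

variable {a : ℝ} {α β : Type} {s t : (α → ℝ) → ℝ}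

theorem comp (f : α → β) (ht : DefinableTerm a t) :
    DefinableTerm a fun v : β → ℝ => t (v ∘ f) :=
  DefinablePred.comp (Sum.map f id) ht

/-- Weakening by one additional variable. -/
theorem lift (ht : DefinableTerm a t) :
    DefinableTerm a fun v : α ⊕ Fin 1 → ℝ => t (v ∘ Sum.inl) :=
  ht.comp _

theorem var (i : α) : DefinableTerm a fun v : α → ℝ => v i :=
  DefinablePred.var_eq (Sum.inr 0) (Sum.inl i)

theorem lt (hs : DefinableTerm a s) (ht : DefinableTerm a t) :
    DefinablePred a fun v => s v < t v :=
  DefinablePred.subst (P := fun v x => x < t v)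
    (DefinablePred.subst (P := fun v x => v (Sum.inr 0) < x) (DefinablePred.var_lt _ _) ht.lift) hs

theorem le (hs : DefinableTerm a s) (ht : DefinableTerm a t) :
    DefinablePred a fun v => s v ≤ t v :=
  (ht.lt hs).not.congr fun _ => not_lt.symm

theorem eq (hs : DefinableTerm a s) (ht : DefinableTerm a t) :
    DefinablePred a fun v => s v = t v :=
  ((hs.le ht).and (ht.le hs)).congr fun _ => le_antisymm_iff

theorem isInt (hs : DefinableTerm a s) : DefinablePred a fun v => ∃ k : ℤ, s v = k :=
  DefinablePred.subst (P := fun _ x => ∃ k : ℤ, x = k) (DefinablePred.var_isInt _) hs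

theorem isIntMul (hs : DefinableTerm a s) : DefinablePred a fun v => ∃ k : ℤ, s v = k * a :=
  DefinablePred.subst (P := fun _ x => ∃ k : ℤ, x = k * a) (DefinablePred.var_isIntMul _) hs

theorem add (hs : DefinableTerm a s) (ht : DefinableTerm a t) :
    DefinableTerm a fun v => s v + t v :=
  DefinablePred.subst (P := fun v x => v (Sum.inr 0) = x + t (v ∘ Sum.inl))
    (DefinablePred.subst (P := fun v x => v (Sum.inl (Sum.inr 0)) = v (Sum.inr 0) + x)
      (DefinablePred.var_eq_add _ _ _) ht.lift.lift) hs.lift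

theorem sub (hs : DefinableTerm a s) (ht : DefinableTerm a t) :
    DefinableTerm a fun v => s v - t v :=
  (eq ((var (Sum.inr 0)).add ht.lift) hs.lift).congr fun _ => eq_sub_iff_add_eq

end DefinableTerm

/-! ### Ostrowski digits: existence, exclusivity and determination of the point. -/

open scoped goldenRatio
open Real

/-- `OpenBetween a b y` says that `y` lies strictly between `a` and `b`, in either order. -/
def OpenBetween (a b y : ℝ) : Prop := a < y ∧ y < b ∨ b < y ∧ y < a

/-- The interval with endpoints `ψ ^ k` and `ψ ^ (k + 1)`, as the dilation of `(ψ, 1)`. -/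
def ConjInterval (k : ℕ) (y : ℝ) : Prop := ∃ z, ψ < z ∧ z < 1 ∧ y = ψ ^ k * z

/-- The points `m φ - n` with `m ≥ 0` in the interval `(ψ, ψ ^ 2)`. -/
def FracPoint (x : ℝ) : Prop :=
  ψ < x ∧ x < ψ ^ 2 ∧ ∃ m n : ℤ, 0 ≤ m ∧ x = m * φ - n

/-- The Ostrowski truncation of `x` to Fibonacci numbers with index at most `k` uses `F_k`. -/
def HasDigit (x : ℝ) (k : ℕ) : Prop :=
  ∃ r t : ℤ, (Nat.fib k : ℤ) ≤ r ∧ r < Nat.fib (k + 1) ∧ ConjInterval (k + 1) (x - (r * φ - t))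

/-- The Ostrowski truncation of `x` to Fibonacci numbers with index at most `k` omits `F_k`. -/
def LacksDigit (x : ℝ) (k : ℕ) : Prop :=
  ∃ r t : ℤ, 0 ≤ r ∧ r < Nat.fib k ∧ ConjInterval k (x - (r * φ - t))

/-- The sign of `ψ ^ k` alternates, so the larger endpoint depends on the parity of `k`. The
unordered form spares the eventual formula any mention of parity. -/
theorem openBetween_iff_conjInterval (k : ℕ) (y : ℝ) :
    OpenBetween (ψ ^ k) (ψ ^ (k + 1)) y ↔ ConjInterval k y := by
  have h0 : ψ ^ k ≠ 0 := pow_ne_zero _ goldenConj_ne_zero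
  have key : ConjInterval k y ↔ ψ < y / ψ ^ k ∧ y / ψ ^ k < 1 := by
    constructor
    · rintro ⟨z, h1, h2, rfl⟩
      rw [mul_div_cancel_left₀ _ h0]
      exact ⟨h1, h2⟩
    · rintro ⟨h1, h2⟩
      exact ⟨_, h1, h2, (mul_div_cancel₀ _ h0).symm⟩
  rw [key, OpenBetween, pow_succ]
  rcases lt_or_gt_of_ne h0 with h | h
  · rw [lt_div_iff_of_neg h, div_lt_iff_of_neg h, one_mul, mul_comm ψ]
    constructor
    · rintro (⟨h1, h2⟩ | ⟨h1, h2⟩)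
      · exact ⟨h2, h1⟩
      · nlinarith [mul_pos_of_neg_of_neg h goldenConj_neg]
    · rintro ⟨h1, h2⟩
      exact Or.inl ⟨h2, h1⟩
  · rw [lt_div_iff₀ h, div_lt_iff₀ h, one_mul, mul_comm ψ]
    constructor
    · rintro (⟨h1, h2⟩ | ⟨h1, h2⟩)
      · nlinarith [mul_neg_of_pos_of_neg h goldenConj_neg]
      · exact ⟨h1, h2⟩
    · rintro ⟨h1, h2⟩
      exact Or.inr ⟨h1, h2⟩

theorem intCast_mul_goldenRatio_sub_inj {m n m' n' : ℤ}
    (h : (m : ℝ) * φ - n = m' * φ - n') : m = m' ∧ n = n' := by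
  have hm : m = m' := by
    by_contra hne
    have h0 : ((m - m' : ℤ) : ℝ) ≠ 0 := by exact_mod_cast sub_ne_zero.2 hne
    refine goldenRatio_irrational ⟨((n - n' : ℤ) : ℚ) / ((m - m' : ℤ) : ℚ), ?_⟩
    push_cast at h0 ⊢
    rw [div_eq_iff h0]
    linarith
  subst hm
  exact ⟨rfl, by exact_mod_cast (by linarith : (n : ℝ) = n')⟩

theorem fib_mul_goldenRatio_sub (k : ℕ) :
    (Nat.fib k : ℝ) * φ - Nat.fib (k + 1) = -ψ ^ k := by
  rw [← fib_succ_sub_goldenRatio_mul_fib]; ring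

/-- The two consecutive Fibonacci vectors have determinant `±1`, hence form a basis of `ℤ²`. -/
theorem exists_fib_combination (k : ℕ) (m t : ℤ) :
    ∃ a b : ℤ, m = a * Nat.fib (k + 1) + b * Nat.fib k ∧
      t = a * Nat.fib (k + 2) + b * Nat.fib (k + 1) := by
  induction k with
  | zero => exact ⟨m, t - m, by simp, by simp⟩
  | succ k ih =>
    obtain ⟨a, b, h1, h2⟩ := ih
    refine ⟨b, a - b, ?_, ?_⟩
    · rw [h1, Nat.fib_add_two]; push_cast; ring
    · rw [h2, Nat.fib_add_two (n := k + 1), Nat.fib_add_two (n := k)]; push_cast; ring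

theorem goldenRatio_mul_goldenConj_pow_succ (k : ℕ) : φ * ψ ^ (k + 1) = -ψ ^ k := by
  rw [pow_succ']
  linear_combination ψ ^ k * goldenRatio_mul_goldenConj

/-- Among the multiples `m φ` with `0 < m < F_{k+1}`, only `F_k φ` has distance less than
`φ ^ (1 - k)` from an integer. -/
theorem eq_fib_of_near_int {k : ℕ} (hk : 1 ≤ k) {m t : ℤ} {q : ℝ} (hm : 0 < m)
    (hm' : m < Nat.fib (k + 1)) (h : (m : ℝ) * φ - t = ψ ^ k * q) (hq : |q| < φ) :
    m = Nat.fib k ∧ t = Nat.fib (k + 1) ∧ q = -1 := by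
  obtain ⟨k, rfl⟩ : ∃ j, k = j + 1 := ⟨k - 1, by omega⟩
  obtain ⟨a, b, rfl, rfl⟩ := exists_fib_combination k m t
  have h0 : ψ ^ (k + 1) ≠ 0 := pow_ne_zero _ goldenConj_ne_zero
  have hqe : q = b * φ - a := by
    refine mul_left_cancel₀ h0 ?_
    rw [← h]
    push_cast
    linear_combination (a : ℝ) * fib_mul_goldenRatio_sub (k + 1) + (b : ℝ) *
      fib_mul_goldenRatio_sub k - (b : ℝ) * goldenRatio_mul_goldenConj_pow_succ k
  rw [abs_lt, hqe] at hq
  have hφ := goldenRatio_pos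
  have hF : (Nat.fib (k + 1 + 1) : ℤ) = Nat.fib k + Nat.fib (k + 1) := by
    exact_mod_cast Nat.fib_add_two
  have hF1 : (0 : ℤ) < Nat.fib (k + 1) := by exact_mod_cast Nat.fib_pos.2 (Nat.succ_pos k)
  have hF0 : (0 : ℤ) ≤ Nat.fib k := by positivity
  have hF2 : (Nat.fib k : ℤ) ≤ Nat.fib (k + 1) := by exact_mod_cast Nat.fib_le_fib_succ
  -- From `|bφ - a| < φ`, a nonzero `b` forces `a` to have the same sign. Both negative gives `m <
  -- 0`; both positive gives `m ≥ F_k + F_{k+1}`, which is the excluded upper bound. With `b = 0`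
  -- only `a = 1` fits, since `2 F_{k+1} ≥ F_{k+2}`.
  rcases lt_trichotomy b 0 with hb | rfl | hb
  · have hb' : (b : ℝ) ≤ -1 := by exact_mod_cast (by omega : b ≤ -1)
    have ha : (a : ℝ) < 0 := by nlinarith
    have ha' : a < 0 := by exact_mod_cast ha
    nlinarith
  · have ha : 0 < a := by
      by_contra hc
      nlinarith
    have ha' : a = 1 := by
      by_contra hc
      have : 2 ≤ a := by omega
      nlinarith
    subst ha'
    simp [hqe]
  · have hb' : (1 : ℝ) ≤ b := by exact_mod_cast hb
    have ha : (0 : ℝ) < a := by nlinarith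
    have ha' : 0 < a := by exact_mod_cast ha
    nlinarith

/-- Subtracting the two truncations yields a multiple of `φ` near an integer, with scaled error `q =
z' - ψz` strictly between `ψ - ψ² = -1` and `1 - ψ = φ`. By `eq_fib_of_near_int` the error would
have to be exactly `-1`. -/
theorem not_lacksDigit_of_hasDigit {x : ℝ} {k : ℕ} (hk : 1 ≤ k) (h : HasDigit x k) :
    ¬ LacksDigit x k := by
  rintro ⟨r', t', hr', hr'', z', hz1', hz2', e'⟩
  obtain ⟨r, t, hr, hr2, z, hz1, hz2, e⟩ := h
  have hψ := goldenConj_neg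
  have hsq := goldenConj_sq
  have hs := goldenRatio_add_goldenConj
  have b1 : ψ * z < ψ ^ 2 := by nlinarith
  have b2 : ψ < ψ * z := by nlinarith
  have := (eq_fib_of_near_int hk (m := r - r') (t := t - t') (q := z' - ψ * z) (by omega)
    (by omega) (by push_cast; rw [pow_succ] at e; linear_combination e' - e)
    (abs_lt.2 ⟨by linarith, by linarith⟩)).2.2
  linarith

/-- Refining an Ostrowski truncation of `x` by one step. -/
theorem ConjInterval.refine {x : ℝ} (hx : FracPoint x) {k : ℕ} {r t : ℤ}
    (hr : r < Nat.fib (k + 1)) (h : ConjInterval k (x - (r * φ - t))) :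
    ConjInterval (k + 1) (x - (r * φ - t)) ∨
      ConjInterval (k + 2) (x - ((r + Nat.fib (k + 1) : ℤ) * φ - (t + Nat.fib (k + 2) : ℤ))) := by
  obtain ⟨-, -, m, n, hm, rfl⟩ := hx
  obtain ⟨z, h1, h2, e⟩ := h
  have hψ := goldenConj_neg
  have hψ0 := goldenConj_ne_zero
  have hsq := goldenConj_sq
  have hψ2 : 0 < ψ ^ 2 := by positivity
  -- The cut point `ψ²` splits `(ψ, 1)` into `ψ·(ψ, 1) = (ψ, ψ²)`, where the truncation is kept, and
  -- `(ψ², 1)`, which translation by `ψ` carries onto `ψ²·(ψ, 1)`; adding `F_{k+1}` to `r` is this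
  -- translation. Hitting the cut would give `m - r = -F_{k+2}`, impossible because `m ≥ 0` and `r <
  -- F_{k+1}`.
  rcases lt_trichotomy z (ψ ^ 2) with hz | hz | hz
  · refine Or.inl ⟨z / ψ, ?_, ?_, ?_⟩
    · rw [lt_div_iff_of_neg hψ]; nlinarith
    · rw [div_lt_iff_of_neg hψ]; linarith
    · rw [e, pow_succ, mul_assoc, mul_div_cancel₀ _ hψ0]
  · exfalso
    have := (intCast_mul_goldenRatio_sub_inj (m := m - r) (n := n - t)
      (m' := -(Nat.fib (k + 2) : ℤ)) (n' := -(Nat.fib (k + 3) : ℤ)) (by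
        push_cast
        rw [hz] at e
        linear_combination e + fib_mul_goldenRatio_sub (k + 2))).1
    have hF : (Nat.fib (k + 1) : ℤ) ≤ Nat.fib (k + 2) := by exact_mod_cast Nat.fib_le_fib_succ
    omega
  · refine Or.inr ⟨(z + ψ) / ψ ^ 2, ?_, ?_, ?_⟩
    · rw [lt_div_iff₀ hψ2]; nlinarith
    · rw [div_lt_iff₀ hψ2]; linarith
    · push_cast
      rw [pow_add ψ k 2, mul_assoc, mul_div_cancel₀ _ hψ2.ne']
      linear_combination e - fib_mul_goldenRatio_sub (k + 1)

theorem fib_succ_cast_le (k : ℕ) : (Nat.fib k : ℤ) ≤ Nat.fib (k + 1) := by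
  exact_mod_cast Nat.fib_le_fib_succ

theorem fib_add_two_cast (k : ℕ) : (Nat.fib (k + 2) : ℤ) = Nat.fib k + Nat.fib (k + 1) := by
  exact_mod_cast Nat.fib_add_two

theorem conjInterval_one {x : ℝ} (hx : FracPoint x) : ConjInterval 1 x := by
  have hψ := goldenConj_neg
  refine ⟨x / ψ, ?_, ?_, by rw [pow_one, mul_div_cancel₀ _ hψ.ne]⟩
  · rw [lt_div_iff_of_neg hψ]; nlinarith [hx.2.1]
  · rw [div_lt_iff_of_neg hψ]; linarith [hx.1]

theorem hasDigit_or_lacksDigit {x : ℝ} (hx : FracPoint x) {k : ℕ} (hk : 1 ≤ k) :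
    HasDigit x k ∨ LacksDigit x k := by
  induction k, hk using Nat.le_induction with
  | base => exact Or.inr ⟨0, 0, le_rfl, by simp, by simpa using conjInterval_one hx⟩
  | succ k hk ih =>
    have hF0 : (0 : ℤ) ≤ Nat.fib k := by positivity
    rcases ih with ⟨r, t, h1, h2, h3⟩ | ⟨r, t, h1, h2, h3⟩
    -- Consecutive Fibonacci numbers are never both used: the witness that uses `F_k` is already one
    -- that omits `F_{k+1}`.
    · exact Or.inr ⟨r, t, by omega, h2, h3⟩
    · have h4 := h2.trans_le (fib_succ_cast_le k)
      rcases h3.refine hx h4 with h | h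
      · exact Or.inr ⟨r, t, h1, h4, h⟩
      · exact Or.inl ⟨_, _, by omega, by rw [fib_add_two_cast]; omega, h⟩

/-- Two points with the same Ostrowski digits have the same truncations. -/
theorem exists_common_truncation {x y : ℝ} (hx : FracPoint x) (hy : FracPoint y)
    (h : ∀ k, 2 ≤ k → (HasDigit x k ↔ HasDigit y k)) {k : ℕ} (hk : 1 ≤ k) :
    ∃ r t : ℤ, 0 ≤ r ∧
      (r < Nat.fib k ∧ ConjInterval k (x - (r * φ - t)) ∧ ConjInterval k (y - (r * φ - t)) ∨
        (Nat.fib k : ℤ) ≤ r ∧ r < Nat.fib (k + 1) ∧ ConjInterval (k + 1) (x - (r * φ - t)) ∧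
          ConjInterval (k + 1) (y - (r * φ - t))) := by
  induction k, hk using Nat.le_induction with
  | base =>
    exact ⟨0, 0, le_rfl, Or.inl ⟨by simp, by simpa using conjInterval_one hx,
      by simpa using conjInterval_one hy⟩⟩
  | succ k hk ih =>
    obtain ⟨r, t, hr, ⟨h1, hxI, hyI⟩ | ⟨h1, h2, hxI, hyI⟩⟩ := ih
    · have h4 := h1.trans_le (fib_succ_cast_le k)
      have has {x : ℝ} (hI : ConjInterval (k + 2)
          (x - ((r + Nat.fib (k + 1) : ℤ) * φ - (t + Nat.fib (k + 2) : ℤ)))) :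
          HasDigit x (k + 1) :=
        ⟨_, _, by omega, by rw [fib_add_two_cast]; omega, hI⟩
      have lacks {x : ℝ} (hI : ConjInterval (k + 1) (x - (r * φ - t))) :
          LacksDigit x (k + 1) := ⟨_, _, hr, h4, hI⟩
      have hk' := h (k + 1) (by omega)
      rcases hxI.refine hx h4 with hX | hX <;> rcases hyI.refine hy h4 with hY | hY
      · exact ⟨r, t, hr, Or.inl ⟨h4, hX, hY⟩⟩
      · exact absurd (lacks hX) (not_lacksDigit_of_hasDigit (by omega) (hk'.2 (has hY)))
      · exact absurd (lacks hY) (not_lacksDigit_of_hasDigit (by omega) (hk'.1 (has hX)))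
      · exact ⟨_, _, by omega, Or.inr ⟨by omega, by rw [fib_add_two_cast]; omega, hX, hY⟩⟩
    · exact ⟨r, t, hr, Or.inl ⟨h2, hxI, hyI⟩⟩

theorem abs_goldenConj_lt_one : |ψ| < 1 :=
  abs_lt.2 ⟨neg_one_lt_goldenConj, goldenConj_neg.trans one_pos⟩

theorem ConjInterval.abs_lt {k : ℕ} {y : ℝ} (h : ConjInterval k y) : |y| < |ψ| ^ k := by
  obtain ⟨z, h1, h2, rfl⟩ := h
  rw [abs_mul, abs_pow]
  have : |z| < 1 := _root_.abs_lt.2 ⟨neg_one_lt_goldenConj.trans h1, h2⟩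
  exact mul_lt_of_lt_one_right (pow_pos (abs_pos.2 goldenConj_ne_zero) _) this

/-- Both points lie within `|ψ| ^ k` of a common truncation, for every `k ≥ 1`, and `|ψ| < 1`. -/
theorem FracPoint.eq_of_digits {x y : ℝ} (hx : FracPoint x) (hy : FracPoint y)
    (h : ∀ k, 2 ≤ k → (HasDigit x k ↔ HasDigit y k)) : x = y := by
  have bound : ∀ k, 1 ≤ k → |x - y| ≤ 2 * |ψ| ^ k := by
    intro k hk
    obtain ⟨r, t, -, ⟨-, hX, hY⟩ | ⟨-, -, hX, hY⟩⟩ := exists_common_truncation hx hy h hk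
    · have := abs_sub (x - (r * φ - t)) (y - (r * φ - t))
      rw [sub_sub_sub_cancel_right] at this
      linarith [hX.abs_lt, hY.abs_lt]
    · have := abs_sub (x - (r * φ - t)) (y - (r * φ - t))
      rw [sub_sub_sub_cancel_right] at this
      have := pow_le_pow_of_le_one (abs_nonneg ψ) abs_goldenConj_lt_one.le k.le_succ
      simp only [Nat.succ_eq_add_one] at this
      linarith [hX.abs_lt, hY.abs_lt]
  have lim : Filter.Tendsto (fun k => 2 * |ψ| ^ k) Filter.atTop (nhds 0) := by
    simpa using (tendsto_pow_atTop_nhds_zero_of_lt_one (abs_nonneg ψ)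
      abs_goldenConj_lt_one).const_mul 2
  have := ge_of_tendsto lim (Filter.eventually_atTop.2 ⟨1, bound⟩)
  exact sub_eq_zero.1 (abs_nonpos_iff.1 this)

/-! ### Multiplication by `ψ` as a shift of digits. -/

theorem goldenConj_lt_neg_half : ψ < -1 / 2 := by
  nlinarith [goldenConj_sq, goldenConj_neg]

/-- On coefficient pairs this is the Fibonacci step `(r, t) ↦ (t, r + t)`, the source of the digit
shift. -/
theorem goldenConj_mul_intCast_mul_goldenRatio_sub (r t : ℝ) :
    ψ * (r * φ - t) = t * φ - (r + t) := by
  linear_combination r * goldenConj_mul_goldenRatio - t * goldenRatio_add_goldenConj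

/-- After multiplication by `ψ`, `t` becomes the new coefficient of `φ`; these are the bounds it
needs in a truncation one index higher. -/
theorem bounds_of_near_int {k : ℕ} {r t : ℤ} (hr : 0 ≤ r) (hr' : r < Nat.fib k)
    (h : |(r : ℝ) * φ - t| < 1) : 0 ≤ t ∧ t < Nat.fib (k + 1) := by
  have hφ := goldenRatio_pos
  have hk : k ≠ 0 := by rintro rfl; simp at hr'; omega
  rw [abs_lt] at h
  constructor
  · have h1 : (0 : ℝ) ≤ r := by exact_mod_cast hr
    have h2 : (-1 : ℝ) < t := by nlinarith
    have h3 : -1 < t := by exact_mod_cast h2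
    omega
  · have h1 : (r : ℝ) + 1 ≤ Nat.fib k := by exact_mod_cast hr'
    have h2 := fib_mul_goldenRatio_sub k
    have h3 : ψ ≤ ψ ^ k := by
      have h4 : |ψ ^ k| ≤ |ψ| := by
        rw [abs_pow]
        exact pow_le_of_le_one (abs_nonneg _) abs_goldenConj_lt_one.le hk
      rw [abs_of_neg goldenConj_neg] at h4
      linarith [neg_abs_le (ψ ^ k)]
    have h5 := goldenRatio_add_goldenConj
    have h6 : (t : ℝ) < Nat.fib (k + 1) := by nlinarith
    exact_mod_cast h6

theorem ConjInterval.goldenConj_mul {k : ℕ} {y : ℝ} (h : ConjInterval k y) :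
    ConjInterval (k + 1) (ψ * y) := by
  obtain ⟨z, h1, h2, rfl⟩ := h
  exact ⟨z, h1, h2, by rw [pow_succ']; ring⟩

/-- The interval `(ψ, ψ²)` is mapped onto `(ψ³, ψ²)`. The sharper lower bound records that the digit
at index 2 of the product vanishes (`not_hasDigit_two`). -/
theorem FracPoint.goldenConj_mul {x : ℝ} (h : FracPoint x) :
    FracPoint (ψ * x) ∧ ψ ^ 3 < ψ * x := by
  obtain ⟨h1, h2, m, n, hm, rfl⟩ := h
  have hψ := goldenConj_neg
  have hsq := goldenConj_sq
  have h3 : ψ ^ 3 < ψ * (m * φ - n) := by rw [pow_succ']; nlinarith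
  have h4 : ψ ^ 3 = 2 * ψ + 1 := by rw [pow_succ', hsq, mul_add, ← sq, hsq]; ring
  refine ⟨⟨?_, by nlinarith, n, m + n, ?_, ?_⟩, h3⟩
  · linarith [neg_one_lt_goldenConj]
  · have h5 : (0 : ℝ) ≤ m := by exact_mod_cast hm
    have h6 : (-1 : ℝ) < n := by nlinarith [goldenRatio_pos, goldenConj_lt_neg_half]
    have h7 : -1 < n := by exact_mod_cast h6
    omega
  · rw [goldenConj_mul_intCast_mul_goldenRatio_sub]; push_cast; ring

theorem LacksDigit.goldenConj_mul {x : ℝ} (hx : FracPoint x) {k : ℕ} (hk : 2 ≤ k)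
    (h : LacksDigit x k) : LacksDigit (ψ * x) (k + 1) := by
  obtain ⟨r, t, h1, h2, h3⟩ := h
  have hsq := goldenConj_sq
  have hb : |(r : ℝ) * φ - t| < 1 := by
    have h4 := h3.abs_lt
    have h5 := pow_le_pow_of_le_one (abs_nonneg ψ) abs_goldenConj_lt_one.le hk
    rw [sq_abs] at h5
    have h6 := _root_.abs_lt.1 (h4.trans_le h5)
    exact _root_.abs_lt.2 ⟨by linarith [hx.1], by linarith [hx.2.1, goldenConj_lt_neg_half]⟩
  obtain ⟨h4, h5⟩ := bounds_of_near_int h1 h2 hb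
  refine ⟨t, r + t, h4, h5, ?_⟩
  convert h3.goldenConj_mul using 1
  rw [mul_sub, goldenConj_mul_intCast_mul_goldenRatio_sub]
  push_cast
  ring

theorem HasDigit.goldenConj_mul {x : ℝ} (hx : FracPoint x) {k : ℕ} (hk : 2 ≤ k)
    (h : HasDigit x k) : HasDigit (ψ * x) (k + 1) := by
  obtain ⟨r, t, h1, h2, h3⟩ := h
  have hψ := goldenConj_neg
  have hsq := goldenConj_sq
  obtain ⟨k, rfl⟩ : ∃ j, k = j + 1 := ⟨k - 1, by omega⟩
  have hF := fib_add_two_cast k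
  have hF' := fib_add_two_cast (k + 1)
  have h2' := h2.trans_eq hF
  -- Removing the leading Fibonacci number leaves a remainder below `F_k`, to which
  -- `bounds_of_near_int` applies.
  have hb : |((r - Nat.fib (k + 1) : ℤ) : ℝ) * φ - (t - Nat.fib (k + 2) : ℤ)| < 1 := by
    obtain ⟨z, hz1, hz2, e⟩ := h3
    have h4 : ((r - Nat.fib (k + 1) : ℤ) : ℝ) * φ - (t - Nat.fib (k + 2) : ℤ) =
        x + ψ ^ (k + 1) * (1 - ψ * z) := by
      push_cast
      rw [pow_succ ψ (k + 1)] at e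
      linear_combination -e - fib_mul_goldenRatio_sub (k + 1)
    have h5 : 0 < 1 - ψ * z := by nlinarith
    have h6 : 1 - ψ * z < 1 - ψ := by nlinarith
    rw [h4]
    have hψ2 : 0 < ψ ^ 2 := sq_pos_of_neg hψ
    -- At exponent 2 the absolute-value estimate is too weak, and the positivity of `ψ²(1 - ψz)` is
    -- needed; from exponent 3 on, `|ψ|³(1 - ψ) = ψ²` suffices.
    rcases eq_or_lt_of_le hk with hk | hk
    · rw [← hk]
      have h7 : ψ ^ 2 * (1 - ψ * z) < ψ ^ 2 * (1 - ψ) :=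
        mul_lt_mul_of_pos_left h6 hψ2
      have h8 : ψ ^ 2 * (1 - ψ) = -ψ := by rw [hsq]; linear_combination -hsq
      have h9 : 0 < ψ ^ 2 * (1 - ψ * z) := mul_pos hψ2 h5
      exact _root_.abs_lt.2 ⟨by linarith [hx.1, neg_one_lt_goldenConj], by linarith [hx.2.1]⟩
    · have h7 := pow_le_pow_of_le_one (abs_nonneg ψ) abs_goldenConj_lt_one.le hk
      have h8 : |ψ ^ (k + 1) * (1 - ψ * z)| < ψ ^ 2 := by
        rw [abs_mul, abs_pow, abs_of_pos h5]
        calc |ψ| ^ (k + 1) * (1 - ψ * z) ≤ |ψ| ^ 3 * (1 - ψ * z) :=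
              mul_le_mul_of_nonneg_right h7 h5.le
          _ < |ψ| ^ 3 * (1 - ψ) :=
              mul_lt_mul_of_pos_left h6 (pow_pos (abs_pos.2 hψ.ne) _)
          _ = ψ ^ 2 := by
              rw [abs_of_neg hψ]; linear_combination ψ ^ 2 * hsq
      have h9 := _root_.abs_lt.1 h8
      exact _root_.abs_lt.2 ⟨by linarith [hx.1], by linarith [hx.2.1, goldenConj_lt_neg_half]⟩
  obtain ⟨h4, h5⟩ := bounds_of_near_int (k := k) (by omega) (by omega) hb
  refine ⟨t, r + t, sub_nonneg.1 h4,
    (show t < Nat.fib (k + 1) + Nat.fib (k + 2) by omega).trans_eq hF'.symm, ?_⟩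
  convert h3.goldenConj_mul using 1
  rw [mul_sub, goldenConj_mul_intCast_mul_goldenRatio_sub]
  push_cast
  ring

/-- Presence and absence of a digit both shift; as they are exhaustive and exclusive, the
implications become an equivalence. -/
theorem hasDigit_goldenConj_mul_iff {x : ℝ} (hx : FracPoint x) {k : ℕ} (hk : 2 ≤ k) :
    HasDigit (ψ * x) (k + 1) ↔ HasDigit x k := by
  refine ⟨fun h => ?_, fun h => h.goldenConj_mul hx hk⟩
  refine (hasDigit_or_lacksDigit hx (by omega)).resolve_right fun h' => ?_
  exact not_lacksDigit_of_hasDigit (by omega) h (h'.goldenConj_mul hx hk)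

/-- On `(ψ³, ψ²)` the zero truncation witnesses that `F_2` is omitted. -/
theorem not_hasDigit_two {x : ℝ} (hx : FracPoint x) (h : ψ ^ 3 < x) : ¬ HasDigit x 2 := fun h' =>
  not_lacksDigit_of_hasDigit (by omega) h' ⟨0, 0, le_rfl, by simp,
    (openBetween_iff_conjInterval 2 _).1 (Or.inr ⟨by simpa using h, by simpa using hx.2.1⟩)⟩

/-- Multiplication by `ψ` is the shift of Ostrowski digits. -/
theorem eq_goldenConj_mul_iff {x y : ℝ} (hx : FracPoint x) :
    y = ψ * x ↔
      FracPoint y ∧ ψ ^ 3 < y ∧ ∀ k, 2 ≤ k → (HasDigit x k ↔ HasDigit y (k + 1)) := by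
  constructor
  · rintro rfl
    exact ⟨hx.goldenConj_mul.1, hx.goldenConj_mul.2,
      fun k hk => (hasDigit_goldenConj_mul_iff hx hk).symm⟩
  · rintro ⟨hy, hy3, h⟩
    refine hy.eq_of_digits hx.goldenConj_mul.1 fun k hk => ?_
    rcases eq_or_lt_of_le hk with rfl | hk
    · exact iff_of_false (not_hasDigit_two hy hy3)
        (not_hasDigit_two hx.goldenConj_mul.1 hx.goldenConj_mul.2)
    · obtain ⟨k, rfl⟩ : ∃ j, k = j + 1 := ⟨k - 1, by omega⟩
      rw [hasDigit_goldenConj_mul_iff hx (by omega), h k (by omega)]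

/-! ### Fibonacci numbers as best approximations, and digits in terms of them. -/

/-- The pair `(v, c) ∈ ℤ φ × ℤ`, with `v` positive, minimizes `|u - t|` over the pairs
`(u, t) ∈ ℤ φ × ℤ` with `0 < u ≤ v`. -/
def BestApprox (v c : ℝ) : Prop :=
  (∃ k : ℤ, v = k * φ) ∧ (∃ k : ℤ, c = k) ∧ 0 < v ∧
    ∀ u t : ℝ, (∃ k : ℤ, u = k * φ) → (∃ k : ℤ, t = k) → 0 < u → u ≤ v → |v - c| ≤ |u - t|

theorem eq_fib_of_abs_lt {k : ℕ} (hk : 1 ≤ k) {m t : ℤ} (hm : 0 < m)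
    (hm' : m < Nat.fib (k + 1)) (h : |(m : ℝ) * φ - t| < |ψ| ^ k * φ) :
    m = Nat.fib k ∧ t = Nat.fib (k + 1) := by
  have h0 : ψ ^ k ≠ 0 := pow_ne_zero _ goldenConj_ne_zero
  have := eq_fib_of_near_int hk hm hm' (mul_div_cancel₀ _ h0).symm
    (by rwa [abs_div, div_lt_iff₀ (abs_pos.2 h0), abs_pow, mul_comm φ])
  exact ⟨this.1, this.2.1⟩

/-- The greatest Fibonacci number `F_k ≤ m` is a competitor with error `|ψ| ^ k`. The gap up to `|ψ|
^ k * φ` in `eq_fib_of_abs_lt` lets non-strict minimality force `m = F_k`. Index 1 is left out: it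
repeats `v = φ` with the worse integer 1 in place of 2. -/
theorem bestApprox_iff {v c : ℝ} :
    BestApprox v c ↔ ∃ k, 2 ≤ k ∧ v = Nat.fib k * φ ∧ c = Nat.fib (k + 1) := by
  have hφ := goldenRatio_pos
  have hlt (k : ℕ) : |ψ| ^ k < |ψ| ^ k * φ :=
    lt_mul_of_one_lt_right (pow_pos (abs_pos.2 goldenConj_ne_zero) _) one_lt_goldenRatio
  have habs (k : ℕ) : |(Nat.fib k : ℝ) * φ - Nat.fib (k + 1)| = |ψ| ^ k := by
    rw [fib_mul_goldenRatio_sub, abs_neg, abs_pow]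
  constructor
  · rintro ⟨⟨m, rfl⟩, ⟨c, rfl⟩, hv, h⟩
    have hm : 0 < m := by exact_mod_cast pos_of_mul_pos_left hv hφ.le
    obtain ⟨k, hkdef⟩ : ∃ k, k = Nat.greatestFib m.toNat := ⟨_, rfl⟩
    have h1 : (Nat.fib k : ℤ) ≤ m := by have := Nat.fib_greatestFib_le m.toNat; rw [← hkdef] at this; omega
    have h2 : m < Nat.fib (k + 1) := by have := Nat.lt_fib_greatestFib_add_one m.toNat; rw [← hkdef] at this; omega
    have hk : 2 ≤ k := by rw [hkdef, Nat.le_greatestFib]; simp; omega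
    have h1' : (Nat.fib k : ℝ) ≤ m := by exact_mod_cast h1
    have hF : (0 : ℝ) < Nat.fib k := by exact_mod_cast Nat.fib_pos.2 (by omega)
    have h3 := h (Nat.fib k * φ) (Nat.fib (k + 1)) ⟨Nat.fib k, by simp⟩ ⟨Nat.fib (k + 1), by simp⟩
      (mul_pos hF hφ) (mul_le_mul_of_nonneg_right h1' hφ.le)
    rw [habs] at h3
    obtain ⟨h4, h5⟩ := eq_fib_of_abs_lt (by omega) hm h2 (h3.trans_lt (hlt k))
    exact ⟨k, hk, by rw [h4]; simp, by rw [h5]; simp⟩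
  · rintro ⟨k, hk, rfl, rfl⟩
    have hF : (0 : ℝ) < Nat.fib k := by exact_mod_cast Nat.fib_pos.2 (by omega)
    refine ⟨⟨Nat.fib k, by simp⟩, ⟨Nat.fib (k + 1), by simp⟩, mul_pos hF hφ, ?_⟩
    rintro _ _ ⟨m, rfl⟩ ⟨t, rfl⟩ hm hm'
    rw [habs]
    by_contra! hc
    have h1 : 0 < m := by exact_mod_cast pos_of_mul_pos_left hm hφ.le
    have h2 : (m : ℤ) ≤ Nat.fib k := by exact_mod_cast le_of_mul_le_mul_right hm' hφ
    have h3 : Nat.fib k < Nat.fib (k + 1) := Nat.fib_lt_fib_succ hk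
    obtain ⟨rfl, rfl⟩ := eq_fib_of_abs_lt (by omega) h1 (by omega) (hc.trans (hlt k))
    have := habs k
    push_cast at hc
    exact hc.ne this

/-- This makes the successor of an index expressible by order and addition alone: `F_{k+1} ≤ 2 F_k <
F_{k+2}`. -/
theorem fib_lt_and_le_two_mul_iff {k j : ℕ} (hk : 2 ≤ k) :
    (Nat.fib k < Nat.fib j ∧ Nat.fib j ≤ Nat.fib k + Nat.fib k) ↔ j = k + 1 := by
  obtain ⟨i, rfl⟩ : ∃ i, k = i + 1 := ⟨k - 1, by omega⟩
  have h1 := Nat.fib_add_two (n := i)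
  have h2 : Nat.fib i ≤ Nat.fib (i + 1) := Nat.fib_le_fib_succ
  have h3 : 0 < Nat.fib i := Nat.fib_pos.2 (by omega)
  have h4 := Nat.fib_add_two (n := i + 1)
  constructor
  · rintro ⟨h5, h6⟩
    have h7 : i + 1 < j := by
      by_contra! hc
      exact absurd (Nat.fib_mono hc) (by omega)
    have h8 : j < i + 3 := by
      by_contra! hc
      have := Nat.fib_mono hc
      have h9 : Nat.fib (i + 3) = Nat.fib (i + 1) + Nat.fib (i + 2) := h4
      omega
    omega
  · rintro rfl
    have h9 : Nat.fib (i + 1 + 1) = Nat.fib i + Nat.fib (i + 1) := h1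
    omega

/-- The digit predicate, in terms of two consecutive best approximations. -/
def DigitAt (x v c w d : ℝ) : Prop :=
  ∃ r t : ℝ, (∃ k : ℤ, r = k * φ) ∧ (∃ k : ℤ, t = k) ∧ v ≤ r ∧ r < w ∧
    OpenBetween (d - w) (c - v + (d - w)) (x - (r - t))

/-- The endpoints are right because `d - w = ψ ^ (k + 1)` and `c - v = ψ ^ k`, whose sum is `ψ ^ (k
+ 2)`. -/
theorem digitAt_fib_iff (x : ℝ) (k : ℕ) :
    DigitAt x (Nat.fib k * φ) (Nat.fib (k + 1)) (Nat.fib (k + 1) * φ) (Nat.fib (k + 2)) ↔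
      HasDigit x k := by
  have hφ := goldenRatio_pos
  have e1 : (Nat.fib (k + 2) : ℝ) - Nat.fib (k + 1) * φ = ψ ^ (k + 1) := by
    linear_combination -fib_mul_goldenRatio_sub (k + 1)
  have e2 : (Nat.fib (k + 1) : ℝ) - Nat.fib k * φ + ψ ^ (k + 1) = ψ ^ (k + 1 + 1) := by
    linear_combination -fib_mul_goldenRatio_sub k - ψ ^ k * goldenConj_sq
  simp only [DigitAt, e1, e2, openBetween_iff_conjInterval, HasDigit]
  constructor
  · rintro ⟨_, _, ⟨r, rfl⟩, ⟨t, rfl⟩, h1, h2, h3⟩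
    exact ⟨r, t, by exact_mod_cast le_of_mul_le_mul_right h1 hφ,
      by exact_mod_cast lt_of_mul_lt_mul_right h2 hφ.le, h3⟩
  · rintro ⟨r, t, h1, h2, h3⟩
    exact ⟨_, _, ⟨r, rfl⟩, ⟨t, rfl⟩,
      mul_le_mul_of_nonneg_right (by exact_mod_cast h1) hφ.le,
      mul_lt_mul_of_pos_right (by exact_mod_cast h2) hφ, h3⟩

/-- Quantification over indices becomes quantification over pairs of consecutive best
approximations; the third one needed for `y` is their sum, by the Fibonacci recurrence. -/
theorem forall_digit_shift_iff {x y : ℝ} :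
    (∀ v c w d, BestApprox v c → BestApprox w d → v < w → w ≤ v + v →
      (DigitAt x v c w d ↔ DigitAt y w d (v + w) (c + d))) ↔
      ∀ k, 2 ≤ k → (HasDigit x k ↔ HasDigit y (k + 1)) := by
  have hφ := goldenRatio_pos
  have hF (k : ℕ) : (Nat.fib (k + 2) : ℝ) = Nat.fib k + Nat.fib (k + 1) := by
    exact_mod_cast Nat.fib_add_two
  have key (k : ℕ) : (DigitAt x (Nat.fib k * φ) (Nat.fib (k + 1)) (Nat.fib (k + 1) * φ)
      (Nat.fib (k + 2)) ↔ DigitAt y (Nat.fib (k + 1) * φ) (Nat.fib (k + 2))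
      (Nat.fib k * φ + Nat.fib (k + 1) * φ) (Nat.fib (k + 1) + Nat.fib (k + 2))) ↔
      (HasDigit x k ↔ HasDigit y (k + 1)) := by
    rw [← add_mul, ← hF, ← hF (k + 1), digitAt_fib_iff, digitAt_fib_iff]
  constructor
  · intro h k hk
    rw [← key]
    obtain ⟨h1, h2⟩ := (fib_lt_and_le_two_mul_iff hk).2 rfl
    refine h _ _ _ _ (bestApprox_iff.2 ⟨k, hk, rfl, rfl⟩)
      (bestApprox_iff.2 ⟨k + 1, by omega, rfl, rfl⟩)
      (mul_lt_mul_of_pos_right (by exact_mod_cast h1) hφ) ?_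
    rw [← add_mul]
    exact mul_le_mul_of_nonneg_right (by exact_mod_cast h2) hφ.le
  · intro h v c w d hv hw h1 h2
    obtain ⟨k, hk, rfl, rfl⟩ := bestApprox_iff.1 hv
    obtain ⟨j, -, rfl, rfl⟩ := bestApprox_iff.1 hw
    rw [← add_mul] at h2
    obtain rfl := (fib_lt_and_le_two_mul_iff hk).1
      ⟨by exact_mod_cast lt_of_mul_lt_mul_right h1 hφ.le,
        by exact_mod_cast le_of_mul_le_mul_right h2 hφ⟩
    exact (key k).2 (h k hk)

/-! ### Reaching all integers, then all real numbers. -/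

/-- The integers `n` for which `n φ` is obtained by multiplying a `FracPoint` by `ψ`. -/
def IsShiftedInt (n : ℤ) : Prop := ∃ m : ℤ, FracPoint (m * φ - n)

/-- The least `m` with `mφ > n + ψ` puts `mφ - n` in `(ψ, 1]`. Either this is below `ψ²`, or
subtracting 1 brings it into `(ψ, 0]`, as `ψ² - 1 = ψ`; equality with `ψ² = -φ + 2` would force `m =
-1`. -/
theorem isShiftedInt_or_succ {n : ℤ} (hn : 1 ≤ n) : IsShiftedInt n ∨ IsShiftedInt (n + 1) := by
  have hφ := goldenRatio_pos
  have hn' : (1 : ℝ) ≤ n := by exact_mod_cast hn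
  have hψ := neg_one_lt_goldenConj
  have hsq := goldenConj_sq
  have hs := goldenRatio_add_goldenConj
  set m := ⌊(n + ψ) / φ⌋ + 1 with hm
  have h1 : n + ψ < m * φ := by
    rw [← div_lt_iff₀ hφ, hm]; push_cast; exact Int.lt_floor_add_one _
  have h2 : (m : ℝ) * φ ≤ n + ψ + φ := by
    have := (le_div_iff₀ hφ).1 (Int.floor_le ((n + ψ) / φ))
    rw [hm]; push_cast; linarith
  have h0 : 0 ≤ m := by
    have : 0 ≤ ⌊(n + ψ) / φ⌋ := Int.floor_nonneg.2 (div_nonneg (by linarith) hφ.le)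
    omega
  rcases lt_trichotomy ((m : ℝ) * φ - n) (ψ ^ 2) with h | h | h
  · exact Or.inl ⟨m, by linarith, h, m, n, h0, rfl⟩
  · exfalso
    have := (intCast_mul_goldenRatio_sub_inj (m := m) (n := n) (m' := -1) (n' := -2)
      (by push_cast; linarith)).1
    omega
  · exact Or.inr ⟨m, by push_cast; linarith, by push_cast; nlinarith [goldenConj_ne_zero],
      m, n + 1, h0, rfl⟩

theorem exists_eq_sub_isShiftedInt (k : ℤ) :
    ∃ n m : ℤ, IsShiftedInt n ∧ IsShiftedInt m ∧ k = n - m := by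
  have hψ := goldenConj_lt_neg_half
  have hψ' := neg_one_lt_goldenConj
  have hsq := goldenConj_sq
  have hs := goldenRatio_add_goldenConj
  -- The points `φ - 2` and `2φ - 3` serve as base points: for `k ≥ 0`, one of `k + 2` and `k + 3`
  -- is a shifted integer.
  have h2 : IsShiftedInt 2 :=
    ⟨1, by push_cast; linarith, by push_cast; nlinarith, 1, 2, by norm_num, rfl⟩
  have h3 : IsShiftedInt 3 :=
    ⟨2, by push_cast; linarith, by push_cast; nlinarith, 2, 3, by norm_num, rfl⟩
  have main : ∀ k : ℤ, 0 ≤ k → ∃ n m : ℤ, IsShiftedInt n ∧ IsShiftedInt m ∧ k = n - m := by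
    intro k hk
    rcases isShiftedInt_or_succ (n := k + 2) (by omega) with h | h
    · exact ⟨_, _, h, h2, by ring⟩
    · exact ⟨_, _, h, h3, by ring⟩
  rcases le_total 0 k with hk | hk
  · exact main k hk
  · obtain ⟨n, m, hn, hm, e⟩ := main (-k) (by omega)
    exact ⟨m, n, hm, hn, by omega⟩

/-- The graph of multiplication by `φ` is determined by its restriction to `ℤ + ℤ φ`
and monotonicity. -/
theorem eq_goldenRatio_mul_iff {x y : ℝ} :
    y = φ * x ↔ ∀ j l : ℤ, ((j : ℝ) + l * φ < x → (j : ℝ) * φ + l * φ + l < y) ∧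
      (x < j + l * φ → y < (j : ℝ) * φ + l * φ + l) := by
  have hφ := goldenRatio_pos
  have e (j l : ℤ) : (j : ℝ) * φ + l * φ + l = φ * (j + l * φ) := by
    linear_combination -(l : ℝ) * goldenRatio_sq
  simp only [e]
  have dense {p q : ℝ} (h : p < q) : ∃ j l : ℤ, p < (j : ℝ) + l * φ ∧ (j : ℝ) + l * φ < q := by
    have hd := dense_addSubgroupClosure_pair_iff.2
      (show Irrational (φ / 1) by simpa using goldenRatio_irrational)
    obtain ⟨z, hz, h1, h2⟩ := hd.exists_between h
    obtain ⟨l, j, rfl⟩ := AddSubgroup.mem_closure_pair.1 hz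
    exact ⟨j, l, by simpa [add_comm] using h1, by simpa [add_comm] using h2⟩
  constructor
  · rintro rfl j l
    exact ⟨fun h => mul_lt_mul_of_pos_left h hφ, fun h => mul_lt_mul_of_pos_left h hφ⟩
  · intro h
    rcases lt_trichotomy y (φ * x) with hy | hy | hy
    · obtain ⟨j, l, h1, h2⟩ := dense ((div_lt_iff₀' hφ).2 hy)
      exact absurd ((div_lt_iff₀' hφ).1 h1) ((h j l).1 h2).le.not_gt
    · exact hy
    · obtain ⟨j, l, h1, h2⟩ := dense ((lt_div_iff₀' hφ).2 hy)
      exact absurd ((lt_div_iff₀' hφ).1 h2) ((h j l).2 h1).le.not_gt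

/-! ### Assembly of the defining formulas. -/

namespace DefinableTerm

variable {α : Type}

theorem abs {a : ℝ} {s : (α → ℝ) → ℝ} (hs : DefinableTerm a s) :
    DefinableTerm a fun v => |s v| := by
  have hx : DefinableTerm a fun w : α ⊕ Fin 1 → ℝ => w (Sum.inr 0) := var _
  have h0 : DefinableTerm a fun w : α ⊕ Fin 1 → ℝ => w (Sum.inr 0) - w (Sum.inr 0) := hx.sub hx
  refine DefinablePred.congr (((h0.le hs.lift).and (hx.eq hs.lift)).or
    ((hs.lift.lt h0).and (h0.eq (hx.add hs.lift)))) fun w => ?_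
  rw [sub_self]
  rcases le_or_gt 0 (s (w ∘ Sum.inl)) with h | h
  · simp [abs_of_nonneg h, h, h.not_gt]
  · simp [abs_of_neg h, h, h.not_ge, eq_neg_iff_add_eq_zero, eq_comm (a := (0 : ℝ))]

theorem zero {a : ℝ} : DefinableTerm a fun _ : α → ℝ => 0 := by
  have hx : DefinableTerm a fun w : α ⊕ Fin 1 → ℝ => w (Sum.inr 0) := var _
  exact (hx.eq (hx.add hx)).congr fun w => by simp

/-- The least positive element of a definable set is definable. -/
theorem of_isLeast_pos {a c : ℝ} {P : ℝ → Prop} (h : IsLeast {x | 0 < x ∧ P x} c)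
    (hP : ∀ {α : Type} {s : (α → ℝ) → ℝ}, DefinableTerm a s → DefinablePred a fun v => P (s v)) :
    DefinableTerm a fun _ : α → ℝ => c := by
  have hx : DefinableTerm a fun w : α ⊕ Fin 1 → ℝ => w (Sum.inr 0) := var _
  refine ((zero.lt hx).and ((hP hx).and (.all (P := fun w y => 0 < y → P y → w (Sum.inr 0) ≤ y)
    ((zero.lt (var _)).imp ((hP (var _)).imp (hx.lift.le (var _))))))).congr fun w => ⟨?_, ?_⟩
  · intro (e : w (Sum.inr 0) = c)
    rw [e]
    exact ⟨h.1.1, h.1.2, fun y h1 h2 => h.2 ⟨h1, h2⟩⟩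
  · rintro ⟨h1, h2, h3⟩
    exact le_antisymm (h3 _ h.1.1 h.1.2) (h.2 ⟨h1, h2⟩)

theorem one {a : ℝ} : DefinableTerm a fun _ : α → ℝ => 1 := by
  refine of_isLeast_pos (P := fun x => ∃ k : ℤ, x = k) ⟨⟨one_pos, 1, by simp⟩, ?_⟩ isInt
  rintro _ ⟨h, k, rfl⟩
  exact_mod_cast h

theorem param {a : ℝ} (ha : 0 < a) : DefinableTerm a fun _ : α → ℝ => a := by
  refine of_isLeast_pos (P := fun x => ∃ k : ℤ, x = k * a) ⟨⟨ha, 1, by simp⟩, ?_⟩ isIntMul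
  rintro _ ⟨h, k, rfl⟩
  have hk : 0 < k := by exact_mod_cast pos_of_mul_pos_left h ha.le
  exact le_mul_of_one_le_left ha.le (by exact_mod_cast hk)

theorem goldenRatio : DefinableTerm φ fun _ : α → ℝ => φ := param goldenRatio_pos

theorem goldenConj : DefinableTerm φ fun _ : α → ℝ => ψ := by
  rw [← one_sub_goldenConj]
  exact one.sub goldenRatio

theorem goldenConj_sq : DefinableTerm φ fun _ : α → ℝ => ψ ^ 2 := by
  rw [Real.goldenConj_sq]
  exact goldenConj.add one

theorem goldenConj_cube : DefinableTerm φ fun _ : α → ℝ => ψ ^ 3 := by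
  rw [show ψ ^ 3 = ψ + ψ ^ 2 by linear_combination ψ * Real.goldenConj_sq]
  exact goldenConj.add goldenConj_sq

variable {x y v c w d : (α → ℝ) → ℝ}

theorem openBetween {a : ℝ} (hx : DefinableTerm a x) (hy : DefinableTerm a y)
    (hv : DefinableTerm a v) : DefinablePred a fun i => OpenBetween (x i) (y i) (v i) :=
  ((hx.lt hv).and (hv.lt hy)).or ((hy.lt hv).and (hv.lt hx))

theorem fracPoint (hx : DefinableTerm φ x) : DefinablePred φ fun i => FracPoint (x i) := by
  refine (goldenConj.lt hx).and ((hx.lt goldenConj_sq).and (DefinablePred.congr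
    (P := fun i => ∃ u t : ℝ, (∃ k : ℤ, u = k * φ) ∧ (∃ k : ℤ, t = k) ∧ 0 ≤ u ∧ x i = u - t)
    (.ex (.ex ?_)) fun i => ⟨?_, ?_⟩))
  · have hu : DefinableTerm φ fun w : (α ⊕ Fin 1) ⊕ Fin 1 → ℝ => w (Sum.inl (Sum.inr 0)) := var _
    have ht : DefinableTerm φ fun w : (α ⊕ Fin 1) ⊕ Fin 1 → ℝ => w (Sum.inr 0) := var _
    exact hu.isIntMul.and (ht.isInt.and ((zero.le hu).and (hx.lift.lift.eq (hu.sub ht))))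
  · rintro ⟨m, n, hm, e⟩
    exact ⟨_, _, ⟨m, rfl⟩, ⟨n, rfl⟩, mul_nonneg (by exact_mod_cast hm) goldenRatio_pos.le, e⟩
  · rintro ⟨_, _, ⟨m, rfl⟩, ⟨n, rfl⟩, hm, e⟩
    exact ⟨m, n, by exact_mod_cast nonneg_of_mul_nonneg_left hm goldenRatio_pos, e⟩

theorem bestApprox (hv : DefinableTerm φ v) (hc : DefinableTerm φ c) :
    DefinablePred φ fun i => BestApprox (v i) (c i) := by
  refine hv.isIntMul.and (hc.isInt.and ((zero.lt hv).and (.all (.all ?_))))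
  have hu : DefinableTerm φ fun w : (α ⊕ Fin 1) ⊕ Fin 1 → ℝ => w (Sum.inl (Sum.inr 0)) := var _
  have ht : DefinableTerm φ fun w : (α ⊕ Fin 1) ⊕ Fin 1 → ℝ => w (Sum.inr 0) := var _
  exact hu.isIntMul.imp (ht.isInt.imp ((zero.lt hu).imp ((hu.le hv.lift.lift).imp
    ((hv.lift.lift.sub hc.lift.lift).abs.le (hu.sub ht).abs))))

theorem digitAt (hx : DefinableTerm φ x) (hv : DefinableTerm φ v) (hc : DefinableTerm φ c)
    (hw : DefinableTerm φ w) (hd : DefinableTerm φ d) :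
    DefinablePred φ fun i => DigitAt (x i) (v i) (c i) (w i) (d i) := by
  refine .ex (.ex ?_)
  have hr : DefinableTerm φ fun w : (α ⊕ Fin 1) ⊕ Fin 1 → ℝ => w (Sum.inl (Sum.inr 0)) := var _
  have ht : DefinableTerm φ fun w : (α ⊕ Fin 1) ⊕ Fin 1 → ℝ => w (Sum.inr 0) := var _
  have hdw := (hd.sub hw).lift.lift
  exact hr.isIntMul.and (ht.isInt.and ((hv.lift.lift.le hr).and ((hr.lt hw.lift.lift).and
    (hdw.openBetween ((hc.sub hv).lift.lift.add hdw) (hx.lift.lift.sub (hr.sub ht))))))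

/-- Multiplication by `ψ` on the set of all `FracPoint`s is definable. -/
theorem eq_goldenConj_mul (hx : DefinableTerm φ x) (hy : DefinableTerm φ y) :
    DefinablePred φ fun i => FracPoint (x i) ∧ y i = ψ * x i := by
  refine DefinablePred.congr (P := fun i => FracPoint (x i) ∧ FracPoint (y i) ∧ ψ ^ 3 < y i ∧
      ∀ v c w d, BestApprox v c → BestApprox w d → v < w → w ≤ v + v →
        (DigitAt (x i) v c w d ↔ DigitAt (y i) w d (v + w) (c + d)))
    (hx.fracPoint.and (hy.fracPoint.and ((goldenConj_cube.lt hy).and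
      (.all (.all (.all (.all ?_))))))) fun i => and_congr_right fun h => ?_
  · have hv : DefinableTerm φ fun w : (((α ⊕ Fin 1) ⊕ Fin 1) ⊕ Fin 1) ⊕ Fin 1 → ℝ =>
      w (Sum.inl (Sum.inl (Sum.inl (Sum.inr 0)))) := var _
    have hc : DefinableTerm φ fun w : (((α ⊕ Fin 1) ⊕ Fin 1) ⊕ Fin 1) ⊕ Fin 1 → ℝ =>
      w (Sum.inl (Sum.inl (Sum.inr 0))) := var _
    have hw : DefinableTerm φ fun w : (((α ⊕ Fin 1) ⊕ Fin 1) ⊕ Fin 1) ⊕ Fin 1 → ℝ =>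
      w (Sum.inl (Sum.inr 0)) := var _
    have hd : DefinableTerm φ fun w : (((α ⊕ Fin 1) ⊕ Fin 1) ⊕ Fin 1) ⊕ Fin 1 → ℝ =>
      w (Sum.inr 0) := var _
    exact (hv.bestApprox hc).imp ((hw.bestApprox hd).imp ((hv.lt hw).imp ((hw.le (hv.add hv)).imp
      ((hx.lift.lift.lift.lift.digitAt hv hc hw hd).iff
        (hy.lift.lift.lift.lift.digitAt hw hd (hv.add hw) (hc.add hd))))))
  · rw [eq_goldenConj_mul_iff h, forall_digit_shift_iff]

/-- With `u = mφ`, the identity `ψ(mφ - n) = nφ - (m + n)` characterizes `nφ` as the element of `ℤφ`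
that differs from `ψ(u - n)` by an integer; irrationality gives uniqueness. -/
theorem isShiftedInt_graph (hx : DefinableTerm φ x) (hy : DefinableTerm φ y) :
    DefinablePred φ fun i => ∃ n : ℤ, IsShiftedInt n ∧ x i = n ∧ y i = n * φ := by
  refine DefinablePred.congr (P := fun i => (∃ n : ℤ, x i = n) ∧ (∃ n : ℤ, y i = n * φ) ∧
      ∃ u t : ℝ, (∃ k : ℤ, u = k * φ) ∧ (∃ k : ℤ, t = k) ∧
        FracPoint (u - x i) ∧ y i - t = ψ * (u - x i))
    (hx.isInt.and (hy.isIntMul.and (.ex (.ex ?_)))) fun i => ⟨?_, ?_⟩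
  · have hu : DefinableTerm φ fun w : (α ⊕ Fin 1) ⊕ Fin 1 → ℝ => w (Sum.inl (Sum.inr 0)) := var _
    have ht : DefinableTerm φ fun w : (α ⊕ Fin 1) ⊕ Fin 1 → ℝ => w (Sum.inr 0) := var _
    exact hu.isIntMul.and (ht.isInt.and
      ((hu.sub hx.lift.lift).eq_goldenConj_mul (hy.lift.lift.sub ht)))
  · rintro ⟨n, ⟨m, hm⟩, hn, hy⟩
    rw [hn, hy]
    refine ⟨⟨n, rfl⟩, ⟨n, rfl⟩, _, _, ⟨m, rfl⟩, ⟨m + n, rfl⟩, hm, ?_⟩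
    rw [goldenConj_mul_intCast_mul_goldenRatio_sub]
    push_cast
    ring
  · rintro ⟨⟨n, hn⟩, ⟨l, hl⟩, _, _, ⟨m, rfl⟩, ⟨t, rfl⟩, h, e⟩
    rw [hn] at h e
    rw [hl, goldenConj_mul_intCast_mul_goldenRatio_sub] at e
    have := (intCast_mul_goldenRatio_sub_inj (m := l) (n := t) (m' := n) (n' := m + n)
      (by push_cast; exact e)).1
    exact ⟨n, ⟨m, h⟩, hn, by rw [hl, this]⟩

/-- Multiplication by `φ` on the integers is definable. -/
theorem int_graph (hx : DefinableTerm φ x) (hy : DefinableTerm φ y) :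
    DefinablePred φ fun i => ∃ n : ℤ, x i = n ∧ y i = n * φ := by
  refine DefinablePred.congr (P := fun i => ∃ n₁ b₁ n₂ b₂ : ℝ,
      (∃ n : ℤ, IsShiftedInt n ∧ n₁ = n ∧ b₁ = n * φ) ∧
      (∃ n : ℤ, IsShiftedInt n ∧ n₂ = n ∧ b₂ = n * φ) ∧ x i = n₁ - n₂ ∧ y i = b₁ - b₂)
    (.ex (.ex (.ex (.ex ?_)))) fun i => ⟨?_, ?_⟩
  · have h₁ : DefinableTerm φ fun w : (((α ⊕ Fin 1) ⊕ Fin 1) ⊕ Fin 1) ⊕ Fin 1 → ℝ =>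
      w (Sum.inl (Sum.inl (Sum.inl (Sum.inr 0)))) := var _
    have h₂ : DefinableTerm φ fun w : (((α ⊕ Fin 1) ⊕ Fin 1) ⊕ Fin 1) ⊕ Fin 1 → ℝ =>
      w (Sum.inl (Sum.inl (Sum.inr 0))) := var _
    have h₃ : DefinableTerm φ fun w : (((α ⊕ Fin 1) ⊕ Fin 1) ⊕ Fin 1) ⊕ Fin 1 → ℝ =>
      w (Sum.inl (Sum.inr 0)) := var _
    have h₄ : DefinableTerm φ fun w : (((α ⊕ Fin 1) ⊕ Fin 1) ⊕ Fin 1) ⊕ Fin 1 → ℝ =>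
      w (Sum.inr 0) := var _
    exact (h₁.isShiftedInt_graph h₂).and ((h₃.isShiftedInt_graph h₄).and
      ((hx.lift.lift.lift.lift.eq (h₁.sub h₃)).and (hy.lift.lift.lift.lift.eq (h₂.sub h₄))))
  · rintro ⟨k, h1, h2⟩
    obtain ⟨n, m, hn, hm, rfl⟩ := exists_eq_sub_isShiftedInt k
    exact ⟨_, _, _, _, ⟨n, hn, rfl, rfl⟩, ⟨m, hm, rfl, rfl⟩, by rw [h1]; push_cast; ring,
      by rw [h2]; push_cast; ring⟩
  · rintro ⟨_, _, _, _, ⟨n, -, rfl, rfl⟩, ⟨m, -, rfl, rfl⟩, h1, h2⟩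
    exact ⟨n - m, by rw [h1]; push_cast; ring, by rw [h2]; push_cast; ring⟩

/-- Multiplication by `φ` on the real numbers is definable. -/
theorem eq_goldenRatio_mul (hx : DefinableTerm φ x) (hy : DefinableTerm φ y) :
    DefinablePred φ fun i => y i = φ * x i := by
  refine DefinablePred.congr (P := fun i => ∀ n b l u : ℝ, (∃ j : ℤ, n = j ∧ b = j * φ) →
      (∃ j : ℤ, l = j ∧ u = j * φ) →
      (n + u < x i → b + u + l < y i) ∧ (x i < n + u → y i < b + u + l))
    (.all (.all (.all (.all ?_)))) fun i => ?_
  · have h₁ : DefinableTerm φ fun w : (((α ⊕ Fin 1) ⊕ Fin 1) ⊕ Fin 1) ⊕ Fin 1 → ℝ =>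
      w (Sum.inl (Sum.inl (Sum.inl (Sum.inr 0)))) := var _
    have h₂ : DefinableTerm φ fun w : (((α ⊕ Fin 1) ⊕ Fin 1) ⊕ Fin 1) ⊕ Fin 1 → ℝ =>
      w (Sum.inl (Sum.inl (Sum.inr 0))) := var _
    have h₃ : DefinableTerm φ fun w : (((α ⊕ Fin 1) ⊕ Fin 1) ⊕ Fin 1) ⊕ Fin 1 → ℝ =>
      w (Sum.inl (Sum.inr 0)) := var _
    have h₄ : DefinableTerm φ fun w : (((α ⊕ Fin 1) ⊕ Fin 1) ⊕ Fin 1) ⊕ Fin 1 → ℝ =>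
      w (Sum.inr 0) := var _
    have hg := h₁.add h₄
    have hh := (h₂.add h₄).add h₃
    have hx' := hx.lift.lift.lift.lift
    have hy' := hy.lift.lift.lift.lift
    exact (h₁.int_graph h₂).imp ((h₃.int_graph h₄).imp
      (((hg.lt hx').imp (hh.lt hy')).and ((hx'.lt hg).imp (hy'.lt hh))))
  · rw [eq_goldenRatio_mul_iff]
    constructor
    · rintro h _ _ _ _ ⟨j, rfl, rfl⟩ ⟨l, rfl, rfl⟩
      exact h j l
    · exact fun h j l => h _ _ _ _ ⟨j, rfl, rfl⟩ ⟨l, rfl, rfl⟩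

end DefinableTerm

theorem theorem5p4 :
    DefinableInR ((1 + Real.sqrt 5) / 2) (fun x : ℝ => (1 + Real.sqrt 5) / 2 * x) :=
  (DefinableTerm.var (0 : Fin 2)).eq_goldenRatio_mul (DefinableTerm.var (1 : Fin 2))
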